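/- Let $(M,g)$ be a smooth Riemannian manifold with Levi-Civita connection $\nabla$. A Kenmotsu structure on $M$ is a quadruple $(\varphi,\eta,\xi,g)$ with $\varphi$ a smooth section of $\mathrm{End}(TM)$, $\xi$ a smooth vector field and $\eta=g(\xi,\cdot)$, such that for all smooth vector fields $X,Y$ $$\varphi^2X=-X+\eta(X)\xi,\quad \eta(\xi)=1,\quad \eta\circ\varphi=0,\quad \varphi\xi=0,\quad g(\varphi X,\varphi Y)=g(X,Y)-\eta(X)\eta(Y),$$ $$(\nabla_X\varphi)Y=g(\varphi X,Y)\xi-\eta(Y)\varphi X .$$ $M$ is a 3-Kenmotsu manifold if it carries three Kenmotsu structures $(\varphi_\alpha,\eta,\xi,g)$, $\alpha=1,2,3$, with the same $\eta,\xi,g$, such that $\varphi_k=\varphi_i\circ\varphi_j$ for every even permutation $(i,j,k)$ of $(1,2,3)$. Put $H=\{X\in TM:\eta(X)=0\}$, $R(X,Y)Z=\nabla_X\nabla_YZ-\nabla_Y\nabla_XZ-\nabla_{[X,Y]}Z$, $R(X,Y,Z,W)=g(R(X,Y)Z,W)$, and for a section $X$ of $H$, at the points where $X\neq0$, $$\mathbf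 H_\alpha(X)=K(X,\varphi_\alpha X)=-\frac{R(X,\varphi_\alpha X,X,\varphi_\alpha X)}{g(X,X)\,g(\varphi_\alpha X,\varphi_\alpha X)-g(X,\varphi_\alpha X)^2}.$$ **Theorem.** Let $M$ be a 3-Kenmotsu manifold, $U\subseteq M$ an open set and $X$ a smooth vector field on $U$ with values in $H$. Then at every point $p\in U$ with $X_p\neq0$, $$\mathbf H_1(X)+\mathbf H_2(X)+\mathbf H_3(X)=-3 .$$ -/

import Mathlib

open Bundle
open scoped Manifold ContDiff

noncomputable section

namespace Riem

section LeviCivita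

/-! ### The Levi-Civita connection of a smooth Riemannian manifold

The metric `g` is given by the Mathlib classes `RiemannianBundle` and
`IsContMDiffRiemannianBundle` on the tangent bundle. The Levi-Civita connection is constructed by
the Koszul formula, and it is proved to be torsion free and compatible with the metric. -/

set_option linter.unusedSectionVars false

variable {E : Type*} [NormedAddCommGroup E] [NormedSpace ℝ E] [FiniteDimensional ℝ E]
  {H : Type*} [TopologicalSpace H] {I : ModelWithCorners ℝ E H}
  {M : Type*} [TopologicalSpace M] [ChartedSpace H M] [IsManifold I ∞ M]
  [RiemannianBundle (fun x : M ↦ TangentSpace I x)]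
  [IsContMDiffRiemannianBundle I ∞ E (fun x : M ↦ TangentSpace I x)]

/-- The function `g(X, Y)`. -/
def metricFun (X Y : Π x : M, TangentSpace I x) (x : M) : ℝ := inner ℝ (X x) (Y x)

/-- The right hand side of the Koszul formula for `g(∇_X Y, Z)` at `x` (note the order of the
arguments `Y`, `X`, `Z`). -/
def koszul (Y X Z : Π x : M, TangentSpace I x) (x : M) : ℝ :=
  (d% (metricFun Y Z) x (X x) + d% (metricFun X Z) x (Y x) - d% (metricFun X Y) x (Z x)
    + inner ℝ (VectorField.mlieBracket I X Y x) (Z x)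
    - inner ℝ (VectorField.mlieBracket I X Z x) (Y x)
    - inner ℝ (VectorField.mlieBracket I Y Z x) (X x)) / 2

lemma metricFun_mdiff {X Y : Π x : M, TangentSpace I x} {x : M}
    (hX : MDiffAt (T% X) x) (hY : MDiffAt (T% Y) x) : MDiffAt (metricFun X Y) x :=
  MDifferentiableAt.inner_bundle (E := fun x : M => TangentSpace I x) (F := E) (b := id) hX hY

lemma metricFun_smul_left (f : M → ℝ) (X Y : Π x : M, TangentSpace I x) :
    metricFun (f • X) Y = f * metricFun X Y := by
  ext x
  simp only [metricFun, Pi.mul_apply]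
  exact real_inner_smul_left (X x) (Y x) (f x)

lemma metricFun_symm (X Y : Π x : M, TangentSpace I x) : metricFun X Y = metricFun Y X := by
  ext x
  exact real_inner_comm _ _

lemma metricFun_smul_right (f : M → ℝ) (X Y : Π x : M, TangentSpace I x) :
    metricFun X (f • Y) = f * metricFun X Y := by
  rw [metricFun_symm, metricFun_smul_left, metricFun_symm]

lemma metricFun_add_left (X Y Z : Π x : M, TangentSpace I x) :
    metricFun (X + Y) Z = metricFun X Z + metricFun Y Z := by
  ext x
  exact inner_add_left (X x) (Y x) (Z x)

lemma metricFun_add_right (X Y Z : Π x : M, TangentSpace I x) :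
    metricFun Z (X + Y) = metricFun Z X + metricFun Z Y := by
  ext x
  exact inner_add_right (Z x) (X x) (Y x)

lemma koszul_tensorial_left {Y Z : Π x : M, TangentSpace I x} {x : M}
    (hY : MDiffAt (T% Y) x) (hZ : MDiffAt (T% Z) x) :
    TensorialAt I E (fun X => koszul Y X Z x) x where
  smul {f X} hf hX := by
    simp only [koszul, metricFun_smul_left, mvfderiv_mul hf (metricFun_mdiff hX hZ),
      mvfderiv_mul hf (metricFun_mdiff hX hY), VectorField.mlieBracket_smul_left hf hX]
    simp [inner_add_left, inner_smul_left, inner_smul_right, metricFun]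
    simp [real_inner_comm]
    ring
  add {X X'} hX hX' := by
    simp only [koszul, metricFun_add_left,
      mvfderiv_add (metricFun_mdiff hX hZ) (metricFun_mdiff hX' hZ),
      mvfderiv_add (metricFun_mdiff hX hY) (metricFun_mdiff hX' hY),
      VectorField.mlieBracket_add_left hX hX']
    simp [inner_add_left, inner_add_right]
    ring

lemma koszul_tensorial_right {Y X : Π x : M, TangentSpace I x} {x : M}
    (hY : MDiffAt (T% Y) x) (hX : MDiffAt (T% X) x) :
    TensorialAt I E (fun Z => koszul Y X Z x) x where
  smul {f Z} hf hZ := by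
    simp only [koszul, metricFun_smul_right, mvfderiv_mul hf (metricFun_mdiff hX hZ),
      mvfderiv_mul hf (metricFun_mdiff hY hZ), VectorField.mlieBracket_smul_right hf hZ]
    simp [inner_add_left, inner_smul_left, inner_smul_right, metricFun]
    simp [real_inner_comm]
    ring
  add {Z Z'} hZ hZ' := by
    simp only [koszul, metricFun_add_right,
      mvfderiv_add (metricFun_mdiff hX hZ) (metricFun_mdiff hX hZ'),
      mvfderiv_add (metricFun_mdiff hY hZ) (metricFun_mdiff hY hZ'),
      VectorField.mlieBracket_add_right hZ hZ']
    simp [inner_add_left, inner_add_right]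
    ring

/-- The bilinear form `(u, w) ↦ g(∇_u Y, w)` on `T_x M`, for `Y` differentiable at `x`. -/
def koszulForm (Y : Π x : M, TangentSpace I x) (x : M) (hY : MDiffAt (T% Y) x) :
    TangentSpace I x →L[ℝ] TangentSpace I x →L[ℝ] ℝ :=
  TensorialAt.mkHom₂ (fun X Z => koszul Y X Z x) x
    (fun _ hZ => koszul_tensorial_left hY hZ) (fun _ hX => koszul_tensorial_right hY hX)

open Classical in
/-- `u ↦ ∇_u Y` at `x`, with the junk value `0` if `Y` is not differentiable at `x`. -/
def leviCivitaFun (Y : Π x : M, TangentSpace I x) (x : M) :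
    TangentSpace I x →L[ℝ] TangentSpace I x :=
  if hY : MDiffAt (T% Y) x then
    haveI : FiniteDimensional ℝ (TangentSpace I x) := inferInstanceAs (FiniteDimensional ℝ E)
    haveI : CompleteSpace (TangentSpace I x) := FiniteDimensional.complete ℝ _
    LinearMap.toContinuousLinearMap
      { toFun := fun u => (InnerProductSpace.toDual ℝ (TangentSpace I x)).symm (koszulForm Y x hY u)
        map_add' := fun u v => by simp
        map_smul' := fun c u => by simp }
  else 0

lemma inner_leviCivitaFun {X Y Z : Π x : M, TangentSpace I x} {x : M} (hX : MDiffAt (T% X) x)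
    (hY : MDiffAt (T% Y) x) (hZ : MDiffAt (T% Z) x) :
    inner ℝ (leviCivitaFun Y x (X x)) (Z x) = koszul Y X Z x := by
  rw [leviCivitaFun, dif_pos hY]
  simp [koszulForm]
  exact TensorialAt.mkHom₂_apply _ _ hX hZ

lemma leviCivitaFun_eq {Y : Π x : M, TangentSpace I x} {x : M} (hY : MDiffAt (T% Y) x)
    {A : TangentSpace I x →L[ℝ] TangentSpace I x}
    (h : ∀ X Z : Π x : M, TangentSpace I x, MDiffAt (T% X) x → MDiffAt (T% Z) x →
      koszul Y X Z x = inner ℝ (A (X x)) (Z x)) : leviCivitaFun Y x = A := by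
  refine ContinuousLinearMap.ext fun u => ext_inner_right ℝ fun w => ?_
  have h1 := h (FiberBundle.extend E u) (FiberBundle.extend E w)
    (FiberBundle.mdifferentiableAt_extend ..) (FiberBundle.mdifferentiableAt_extend ..)
  rw [← inner_leviCivitaFun (FiberBundle.mdifferentiableAt_extend ..) hY
    (FiberBundle.mdifferentiableAt_extend ..)] at h1
  simpa using h1

/-- The Levi-Civita connection: `leviCivita Y x v` is `∇_v Y` at `x`, for `v ∈ T_x M`. -/
def leviCivita : CovariantDerivative I E (TangentSpace I : M → Type _) where
  toFun := leviCivitaFun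
  isCovariantDerivativeOnUniv :=
    { add := by
        intro Y Y' x hY hY' _
        refine leviCivitaFun_eq (mdifferentiableAt_add_section hY hY') fun X Z hX hZ => ?_
        simp only [add_apply]
        rw [inner_add_left, inner_leviCivitaFun hX hY hZ, inner_leviCivitaFun hX hY' hZ]
        simp only [koszul, metricFun_add_left, metricFun_add_right,
          mvfderiv_add (metricFun_mdiff hY hZ) (metricFun_mdiff hY' hZ),
          mvfderiv_add (metricFun_mdiff hX hY) (metricFun_mdiff hX hY'),
          VectorField.mlieBracket_add_left hY hY', VectorField.mlieBracket_add_right hY hY']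
        simp [inner_add_left, inner_add_right]
        ring
      leibniz := by
        intro Y f x hY hf _
        refine leviCivitaFun_eq (hf.smul_section hY) fun X Z hX hZ => ?_
        have h1 : inner ℝ ((f x • leviCivitaFun Y x + (d% f x).smulRight (Y x)) (X x)) (Z x)
            = f x * inner ℝ (leviCivitaFun Y x (X x)) (Z x)
              + (d% f x (X x)) * inner ℝ (Y x) (Z x) := by
          simp [inner_add_left, inner_smul_left]
        rw [h1, inner_leviCivitaFun hX hY hZ]
        simp only [koszul, metricFun_smul_right, metricFun_smul_left,
          mvfderiv_mul hf (metricFun_mdiff hY hZ), mvfderiv_mul hf (metricFun_mdiff hX hY),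
          VectorField.mlieBracket_smul_left hf hY, VectorField.mlieBracket_smul_right hf hY]
        simp [inner_add_left, inner_smul_left, inner_smul_right, metricFun]
        simp [real_inner_comm]
        ring }

/-- The Levi-Civita connection is torsion free. -/
theorem leviCivita_torsion : (leviCivita (I := I) (M := M)).torsion = 0 := by
  rw [CovariantDerivative.torsion_eq_zero_iff]
  intro X Y x hX hY
  refine ext_inner_right ℝ fun w => ?_
  have hZ := FiberBundle.mdifferentiableAt_extend I E w
  have h1 := inner_leviCivitaFun hX hY hZ
  have h2 := inner_leviCivitaFun hY hX hZ
  rw [inner_sub_left]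
  simp only [FiberBundle.extend_apply_self] at h1 h2
  erw [h1, h2]
  simp only [koszul, metricFun_symm Y X, VectorField.mlieBracket_swap_apply (V := Y) (W := X)]
  simp
  ring

/-- The Levi-Civita connection is compatible with the metric. -/
theorem leviCivita_isMetricCompatible :
    CovariantDerivative.IsMetricCompatible (V := fun x : M => TangentSpace I x)
      (leviCivita (I := I) (M := M)) := by
  rw [CovariantDerivative.isMetricCompatible_iff]
  intro x X Y Z hX hY hZ
  change _ = inner ℝ (leviCivita Y x (X x)) (Z x) + inner ℝ (Y x) (leviCivita Z x (X x))
  rw [real_inner_comm (leviCivita Z x (X x))]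
  have h1 := inner_leviCivitaFun hX hY hZ
  have h2 := inner_leviCivitaFun hX hZ hY
  erw [h1, h2]
  simp only [koszul, metricFun_symm Z Y, VectorField.mlieBracket_swap_apply (V := Z) (W := Y)]
  simp
  have h3 : (fun y => (inner ℝ (Y y) (Z y) : ℝ)) = metricFun Y Z := rfl
  rw [h3]
  ring

end LeviCivita

section Curvature

variable {E : Type*} [NormedAddCommGroup E] [NormedSpace ℝ E] [FiniteDimensional ℝ E]
  {H : Type*} [TopologicalSpace H] {I : ModelWithCorners ℝ E H}
  {M : Type*} [TopologicalSpace M] [ChartedSpace H M] [IsManifold I ∞ M]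
  [RiemannianBundle (fun x : M ↦ TangentSpace I x)]
  [IsContMDiffRiemannianBundle I ∞ E (fun x : M ↦ TangentSpace I x)]

/-- The vector field `∇_X Y`. -/
def nabla (X Y : Π x : M, TangentSpace I x) (x : M) : TangentSpace I x := leviCivita Y x (X x)

/-- The curvature `R(X, Y) Z = ∇_X ∇_Y Z - ∇_Y ∇_X Z - ∇_[X, Y] Z`. -/
def curvature (X Y Z : Π x : M, TangentSpace I x) (x : M) : TangentSpace I x :=
  nabla X (nabla Y Z) x - nabla Y (nabla X Z) x - nabla (VectorField.mlieBracket I X Y) Z x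

/-- `R(X, Y, Z, W) = g(R(X, Y) Z, W)`. -/
def curvature₄ (X Y Z W : Π x : M, TangentSpace I x) (x : M) : ℝ :=
  inner ℝ (curvature X Y Z x) (W x)

/-- The sectional curvature `K(X, Y)` of the plane spanned by `X x` and `Y x`. -/
def sectionalCurvature (X Y : Π x : M, TangentSpace I x) (x : M) : ℝ :=
  -(curvature₄ X Y X Y x) /
    (metricFun X X x * metricFun Y Y x - metricFun X Y x ^ 2)

/-- The vector field `φ X`, for a field `φ` of endomorphisms of the tangent spaces. -/
def applyField (φ : Π x : M, TangentSpace I x →L[ℝ] TangentSpace I x)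
    (X : Π x : M, TangentSpace I x) (x : M) : TangentSpace I x := φ x (X x)

/-- The `φ`-holomorphic sectional curvature `K(X, φ X)`. -/
def holomorphicSectionalCurvature (φ : Π x : M, TangentSpace I x →L[ℝ] TangentSpace I x)
    (X : Π x : M, TangentSpace I x) (x : M) : ℝ :=
  sectionalCurvature X (applyField φ X) x

end Curvature

section Kenmotsu

variable {E : Type*} [NormedAddCommGroup E] [NormedSpace ℝ E] [FiniteDimensional ℝ E]
  {H : Type*} [TopologicalSpace H] {I : ModelWithCorners ℝ E H}
  {M : Type*} [TopologicalSpace M] [ChartedSpace H M] [IsManifold I ∞ M]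
  [RiemannianBundle (fun x : M ↦ TangentSpace I x)]

/-- `(φ, η, ξ, g)` is an almost contact metric structure. -/
structure IsAlmostContactMetric (φ : Π x : M, TangentSpace I x →L[ℝ] TangentSpace I x)
    (η : Π x : M, TangentSpace I x →L[ℝ] ℝ) (ξ : Π x : M, TangentSpace I x) : Prop where
  /-- `φ` is a smooth section of `End(TM)`. -/
  contMDiff_endo : ContMDiff I (I.prod 𝓘(ℝ, E →L[ℝ] E)) ∞
    (fun x ↦ TotalSpace.mk' (E →L[ℝ] E) (E := fun x : M ↦ TangentSpace I x →L[ℝ] TangentSpace I x)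
      x (φ x))
  /-- `ξ` is a smooth vector field. -/
  contMDiff_reeb : ContMDiff I I.tangent ∞ (fun x ↦ (⟨x, ξ x⟩ : TangentBundle I M))
  /-- `η` is the `1`-form dual to `ξ`. -/
  dual : ∀ x (v : TangentSpace I x), η x v = inner ℝ (ξ x) v
  sq : ∀ x (v : TangentSpace I x), φ x (φ x v) = -v + η x v • ξ x
  form_reeb : ∀ x, η x (ξ x) = 1
  form_endo : ∀ x (v : TangentSpace I x), η x (φ x v) = 0
  endo_reeb : ∀ x, φ x (ξ x) = 0
  metric_endo : ∀ x (v w : TangentSpace I x),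
    inner ℝ (φ x v) (φ x w) = inner ℝ v w - η x v * η x w

/-- The distribution `H = {X | η(X) = 0}`. -/
def horizontal (η : Π x : M, TangentSpace I x →L[ℝ] ℝ) (x : M) :
    Submodule ℝ (TangentSpace I x) := LinearMap.ker (η x : TangentSpace I x →ₗ[ℝ] ℝ)

variable [IsContMDiffRiemannianBundle I ∞ E (fun x : M ↦ TangentSpace I x)]

/-- `(∇_X φ) Y = ∇_X (φ Y) - φ (∇_X Y)`. -/
def nablaEndo (φ : Π x : M, TangentSpace I x →L[ℝ] TangentSpace I x)
    (X Y : Π x : M, TangentSpace I x) (x : M) : TangentSpace I x :=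
  nabla X (applyField φ Y) x - φ x (nabla X Y x)

/-- `(φ, η, ξ, g)` is a Kenmotsu structure: it is an almost contact metric structure with
`(∇_X φ) Y = g(φ X, Y) ξ - η(Y) φ X`. The identity is required at each point `x` for all vector
fields that are smooth near `x`. -/
structure IsKenmotsu (φ : Π x : M, TangentSpace I x →L[ℝ] TangentSpace I x)
    (η : Π x : M, TangentSpace I x →L[ℝ] ℝ) (ξ : Π x : M, TangentSpace I x) : Prop
    extends IsAlmostContactMetric φ η ξ where
  nabla_endo : ∀ (x : M) (X Y : Π x : M, TangentSpace I x),
    ContMDiffAt I I.tangent ∞ (fun y ↦ (⟨y, X y⟩ : TangentBundle I M)) x →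
    ContMDiffAt I I.tangent ∞ (fun y ↦ (⟨y, Y y⟩ : TangentBundle I M)) x →
    nablaEndo φ X Y x = (inner ℝ (φ x (X x)) (Y x) : ℝ) • ξ x - η x (Y x) • φ x (X x)

/-- `(φ₁, φ₂, φ₃, η, ξ, g)` is a 3-Kenmotsu structure, where `φ 0`, `φ 1`, `φ 2` stand for `φ₁`,
`φ₂`, `φ₃`: each `(φ_α, η, ξ, g)` is a Kenmotsu structure and `φ_k = φ_i ∘ φ_j` for all even
permutations `(i, j, k)`. -/
structure IsThreeKenmotsu (φ : Fin 3 → Π x : M, TangentSpace I x →L[ℝ] TangentSpace I x)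
    (η : Π x : M, TangentSpace I x →L[ℝ] ℝ) (ξ : Π x : M, TangentSpace I x) : Prop where
  isKenmotsu : ∀ α, IsKenmotsu (φ α) η ξ
  comp₁₂ : ∀ x (v : TangentSpace I x), φ 2 x v = φ 0 x (φ 1 x v)
  comp₂₃ : ∀ x (v : TangentSpace I x), φ 0 x v = φ 1 x (φ 2 x v)
  comp₃₁ : ∀ x (v : TangentSpace I x), φ 1 x v = φ 2 x (φ 0 x v)

end Kenmotsu

end Riem

end

/-!
The difference between the curvature `R` of a Kenmotsu manifold and the curvature tensor of
constant curvature `-1` commutes with `φ` on horizontal fields (`IsKenmotsu.curvature_applyField`).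
This follows from `∇_Y ξ = Y - η(Y) ξ` (`IsKenmotsu.nabla_reeb`) by differentiating the identity for
`(∇_Y φ) Z` once more. On a 3-Kenmotsu manifold the difference therefore behaves on horizontal
vectors like the curvature tensor of a hyperkähler manifold, whose three holomorphic sectional
curvatures have sum zero: the first Bianchi identity for `X`, `φ₁ X`, `φ₂ X`, paired with `φ₃ X`,
has as its summands, up to sign, the numerators for `φ₁`, `φ₃` and `φ₂`. So the sum for `R` is the
one for constant curvature `-1`, that is, `-3` (`IsThreeKenmotsu.sum_curvature₄`).

The symmetries of `R` used here are the first Bianchi identity (`curvature_bianchi`), the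
skew-symmetry in the last two arguments (`curvature₄_antisymm_right`) and the symmetry in pairs
(`curvature₄_pair_symm`). They need iterated covariant derivatives, hence the smoothness of
`∇_X Y` (`contMDiffAt_nabla`), which the Koszul formula gives through inner products only, and the
formula for the derivation along a Lie bracket (`mvfderiv_mlieBracket`).
-/

noncomputable section

namespace Riem

set_option linter.unusedSectionVars false

open Filter Topology VectorField

variable {E : Type*} [NormedAddCommGroup E] [NormedSpace ℝ E] [FiniteDimensional ℝ E]
  {H : Type*} [TopologicalSpace H] {I : ModelWithCorners ℝ E H}
  {M : Type*} [TopologicalSpace M] [ChartedSpace H M] [IsManifold I ∞ M]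
  [RiemannianBundle (fun x : M ↦ TangentSpace I x)]
  [IsContMDiffRiemannianBundle I ∞ E (fun x : M ↦ TangentSpace I x)]

/-! ### Smoothness of the Levi-Civita connection -/

lemma contMDiffAt_mvfderiv_apply {f : M → ℝ} {X : Π x : M, TangentSpace I x} {x : M}
    (hf : CMDiffAt ∞ f x) (hX : CMDiffAt ∞ (T% X) x) :
    CMDiffAt ∞ (fun y ↦ d% f y (X y)) x := by
  have h1 := hf.mfderiv_const (m := ∞) (by simp)
  have h2 := ContMDiffAt.clm_apply_of_inCoordinates (b₂ := f) h1 hX hf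
  exact (contMDiff_snd_tangentBundle_modelSpace ℝ 𝓘(ℝ, ℝ)).contMDiffAt.comp x h2

lemma contMDiffAt_metricFun {X Y : Π x : M, TangentSpace I x} {x : M}
    (hX : CMDiffAt ∞ (T% X) x) (hY : CMDiffAt ∞ (T% Y) x) : CMDiffAt ∞ (metricFun X Y) x :=
  ContMDiffAt.inner_bundle (E := fun x : M => TangentSpace I x) (F := E) (b := id) hX hY

/-- A vector field is smooth if its inner products with smooth vector fields are. Its coefficients
in a local frame solve a linear system with the Gram matrix of the frame, which is smooth and
invertible, so that Cramer's rule applies. -/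
lemma contMDiffAt_of_metricFun {V : Π x : M, TangentSpace I x} {x : M}
    (h : ∀ Z : Π x : M, TangentSpace I x, CMDiffAt ∞ (T% Z) x → CMDiffAt ∞ (metricFun V Z) x) :
    CMDiffAt ∞ (T% V) x := by
  let e := trivializationAt E (TangentSpace I : M → Type _) x
  let b := Module.finBasis ℝ E
  have hx : x ∈ e.baseSet := FiberBundle.mem_baseSet_trivializationAt' x
  have hfr := e.isLocalFrameOn_localFrame_baseSet I ∞ b
  have hs : ∀ i, CMDiffAt ∞ (T% (e.localFrame b i)) x := fun i ↦
    contMDiffAt_localFrame_of_mem ∞ e b i hx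
  let G : M → Matrix _ _ ℝ := fun y ↦ Matrix.gram ℝ (fun i ↦ e.localFrame b i y)
  let β := fun (y : M) i ↦ metricFun V (e.localFrame b i) y
  refine hfr.contMDiffAt_of_coeff (fun i ↦ ?_) (e.open_baseSet.mem_nhds hx)
  have hdet : ∀ A : M → Matrix (Fin (Module.finrank ℝ E)) (Fin (Module.finrank ℝ E)) ℝ,
      (∀ i j, CMDiffAt ∞ (fun y ↦ A y i j) x) → CMDiffAt ∞ (fun y ↦ (A y).det) x := by
    intro A hA
    simp only [Matrix.det_apply']
    exact ContMDiffAt.sum fun σ _ ↦ contMDiffAt_const.mul <| ContMDiffAt.prod fun j _ ↦ hA _ _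
  have hG : ∀ i j, CMDiffAt ∞ (fun y ↦ G y i j) x := fun i j ↦
    contMDiffAt_metricFun (hs i) (hs j)
  have hβ : ∀ i, CMDiffAt ∞ (fun y ↦ β y i) x := fun i ↦ h _ (hs i)
  have hG0 : ∀ y ∈ e.baseSet, (G y).det ≠ 0 := fun y hy ↦
    Matrix.det_gram_ne_zero_iff_linearIndependent.2 (hfr.linearIndependent hy)
  have hc : CMDiffAt ∞ (fun y ↦ (G y).cramer (β y) i / (G y).det) x := by
    refine ContMDiffAt.div₀ ?_ (hdet _ hG) (hG0 x hx)
    simp only [Matrix.cramer_apply]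
    refine hdet _ fun k l ↦ ?_
    by_cases hl : l = i
    · subst hl
      simpa using hβ k
    · simpa [Matrix.updateCol_apply, hl] using hG k l
  refine hc.congr_of_eventuallyEq ?_
  filter_upwards [e.open_baseSet.mem_nhds hx] with y hy
  have h1 : Matrix.mulVec (G y) (fun i ↦ hfr.coeff i y (V y)) = β y := by
    ext k
    have h2 := hfr.coeff_sum_eq V hy
    simp only [β, metricFun]
    conv_rhs => rw [h2]
    rw [sum_inner]
    simp only [Matrix.mulVec, dotProduct]
    refine Finset.sum_congr rfl fun j _ ↦ ?_
    rw [real_inner_smul_left, real_inner_comm, mul_comm]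
    rfl
  rw [eq_div_iff (hG0 y hy), ← h1, Matrix.cramer_eq_adjugate_mulVec, Matrix.mulVec_mulVec,
    Matrix.adjugate_mul]
  simp [Matrix.smul_mulVec]
  ring

lemma mdiff_of_contMDiffAt {V : Π x : M, TangentSpace I x} {p : M}
    (h : CMDiffAt ∞ (T% V) p) : MDiffAt (T% V) p :=
  h.mdifferentiableAt (by simp)

lemma eventually_mdifferentiableAt {V : Π x : M, TangentSpace I x} {x : M}
    (h : CMDiffAt ∞ (T% V) x) : ∀ᶠ y in 𝓝 x, MDiffAt (T% V) y :=
  ((contMDiffAt_iff_contMDiffAt_nhds (by simp)).1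
    (h.of_le (show (1 : WithTop ℕ∞) ≤ ∞ by simp))).mono
      fun _ hy ↦ hy.mdifferentiableAt one_ne_zero

lemma contMDiffAt_mlieBracket {X Y : Π x : M, TangentSpace I x} {x : M}
    (hX : CMDiffAt ∞ (T% X) x) (hY : CMDiffAt ∞ (T% Y) x) :
    CMDiffAt ∞ (T% (mlieBracket I X Y)) x := by
  have : IsManifold I (minSmoothness ℝ 2) M := by
    rw [minSmoothness_of_isRCLikeNormedField]; infer_instance
  have : IsManifold I (((⊤ : ℕ∞) : WithTop ℕ∞) + 1) M := inferInstanceAs (IsManifold I ∞ M)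
  exact ContMDiffAt.mlieBracket_vectorField (n := ⊤) (m := ⊤) hX hY (by simp)

/-- `∇_X Y` is smooth where `X` and `Y` are: its inner products are given by the Koszul formula. -/
lemma contMDiffAt_nabla {X Y : Π x : M, TangentSpace I x} {x : M}
    (hX : CMDiffAt ∞ (T% X) x) (hY : CMDiffAt ∞ (T% Y) x) :
    CMDiffAt ∞ (T% (nabla X Y)) x := by
  refine contMDiffAt_of_metricFun fun Z hZ ↦ ?_
  have hk : CMDiffAt ∞ (koszul Y X Z) x := by
    unfold koszul
    have h1 := contMDiffAt_mvfderiv_apply (I := I) (contMDiffAt_metricFun hY hZ) hX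
    have h2 := contMDiffAt_mvfderiv_apply (I := I) (contMDiffAt_metricFun hX hZ) hY
    have h3 := contMDiffAt_mvfderiv_apply (I := I) (contMDiffAt_metricFun hX hY) hZ
    have h4 := contMDiffAt_metricFun (contMDiffAt_mlieBracket hX hY) hZ
    have h5 := contMDiffAt_metricFun (contMDiffAt_mlieBracket hX hZ) hY
    have h6 := contMDiffAt_metricFun (contMDiffAt_mlieBracket hY hZ) hX
    exact (((((h1.add h2).sub h3).add h4).sub h5).sub h6).div_const 2
  refine hk.congr_of_eventuallyEq ?_
  filter_upwards [eventually_mdifferentiableAt hX, eventually_mdifferentiableAt hY,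
    eventually_mdifferentiableAt hZ] with y h1 h2 h3
  exact inner_leviCivitaFun h1 h2 h3

variable {W X Y Z : Π x : M, TangentSpace I x} {f : M → ℝ} {p : M}

/-! ### The Levi-Civita connection along vector fields -/

lemma nabla_add_right (hY : MDiffAt (T% Y) p) (hZ : MDiffAt (T% Z) p) :
    nabla X (Y + Z) p = nabla X Y p + nabla X Z p := by
  simp only [nabla]
  rw [leviCivita.isCovariantDerivativeOnUniv.add hY hZ]
  rfl

lemma nabla_smul_right (hf : MDiffAt f p) (hY : MDiffAt (T% Y) p) :
    nabla X (f • Y) p = f p • nabla X Y p + d% f p (X p) • Y p := by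
  simp only [nabla]
  rw [leviCivita.isCovariantDerivativeOnUniv.leibniz hY hf]
  rfl

lemma nabla_congr (hY : MDiffAt (T% Y) p) (hZ : MDiffAt (T% Z) p) (h : ∀ᶠ y in 𝓝 p, Y y = Z y) :
    nabla X Y p = nabla X Z p := by
  simp only [nabla]
  rw [leviCivita.isCovariantDerivativeOnUniv.congr_of_eventuallyEq hY hZ univ_mem h]

lemma nabla_sub_nabla (hX : MDiffAt (T% X) p) (hY : MDiffAt (T% Y) p) :
    nabla X Y p - nabla Y X p = mlieBracket I X Y p :=
  (CovariantDerivative.torsion_eq_zero_iff _).1 leviCivita_torsion hX hY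

lemma mvfderiv_metricFun (hX : MDiffAt (T% X) p) (hY : MDiffAt (T% Y) p) (hZ : MDiffAt (T% Z) p) :
    d% (metricFun Y Z) p (X p) = inner ℝ (nabla X Y p) (Z p) + inner ℝ (Y p) (nabla X Z p) :=
  (CovariantDerivative.isMetricCompatible_iff _).1 leviCivita_isMetricCompatible hX hY hZ

lemma mvfderiv_congr {f g : M → ℝ} (h : f =ᶠ[𝓝 p] g) : d% f p = d% g p := by
  change (mfderiv I 𝓘(ℝ, ℝ) f p : E →L[ℝ] ℝ) = mfderiv I 𝓘(ℝ, ℝ) g p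
  exact h.mfderiv_eq

/-- The derivation along `[X, Y]` is the commutator of the derivations along `X` and `Y`. It is
obtained by comparing the Jacobi identities for `X`, `Y`, `Z` and for `X`, `Y`, `f • Z`, where
`Z p ≠ 0`. -/
lemma mvfderiv_mlieBracket (hf : CMDiffAt ∞ f p) (hX : CMDiffAt ∞ (T% X) p)
    (hY : CMDiffAt ∞ (T% Y) p) :
    d% f p (mlieBracket I X Y p)
      = d% (fun y ↦ d% f y (Y y)) p (X p) - d% (fun y ↦ d% f y (X y)) p (Y p) := by
  by_cases h0 : ∀ v : TangentSpace I p, v = 0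
  · rw [h0 (mlieBracket I X Y p), h0 (X p), h0 (Y p)]
    simp
  push Not at h0
  obtain ⟨v, hv⟩ := h0
  have : IsManifold I (minSmoothness ℝ 3) M := by
    rw [minSmoothness_of_isRCLikeNormedField]; infer_instance
  let Z : Π x : M, TangentSpace I x := FiberBundle.extend E v
  have hZ : CMDiffAt ∞ (T% Z) p := FiberBundle.contMDiffAt_extend I E v
  have hZp : Z p = v := FiberBundle.extend_apply_self ..
  have hfZ : CMDiffAt ∞ (T% (f • Z)) p := hf.smul_section hZ
  have hle : minSmoothness ℝ 2 ≤ (∞ : WithTop ℕ∞) := by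
    rw [minSmoothness_of_isRCLikeNormedField]
    exact WithTop.coe_le_coe.2 le_top
  have hf1 : ∀ᶠ y in 𝓝 p, MDiffAt f y :=
    ((contMDiffAt_iff_contMDiffAt_nhds (by simp)).1
      (hf.of_le (show (1 : WithTop ℕ∞) ≤ ∞ by simp))).mono
        fun _ hy ↦ hy.mdifferentiableAt one_ne_zero
  have key : ∀ {A B : Π x : M, TangentSpace I x}, CMDiffAt ∞ (T% A) p → CMDiffAt ∞ (T% B) p →
      mlieBracket I A (mlieBracket I B (f • Z)) p
        = d% (fun y ↦ d% f y (B y)) p (A p) • Z p + d% f p (B p) • mlieBracket I A Z p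
          + (d% f p (A p) • mlieBracket I B Z p + f p • mlieBracket I A (mlieBracket I B Z) p) := by
    intro A B hA hB
    have hfB := contMDiffAt_mvfderiv_apply hf hB
    have h1 : mlieBracket I B (f • Z) =ᶠ[𝓝 p]
        (fun y ↦ d% f y (B y)) • Z + f • mlieBracket I B Z := by
      filter_upwards [hf1, eventually_mdifferentiableAt hZ] with y h1 h2
      exact mlieBracket_smul_right h1 h2
    have hBZ := contMDiffAt_mlieBracket hB hZ
    rw [EventuallyEq.rfl.mlieBracket_vectorField_eq h1,
      mlieBracket_add_right (mdiff_of_contMDiffAt (hfB.smul_section hZ))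
        (mdiff_of_contMDiffAt (hf.smul_section hBZ)),
      mlieBracket_smul_right (hfB.mdifferentiableAt (by simp)) (mdiff_of_contMDiffAt hZ),
      mlieBracket_smul_right hf1.self_of_nhds (mdiff_of_contMDiffAt hBZ)]
  have h1 := leibniz_identity_mlieBracket_apply (hX.of_le hle) (hY.of_le hle) (hfZ.of_le hle)
  have h2 := leibniz_identity_mlieBracket_apply (hX.of_le hle) (hY.of_le hle) (hZ.of_le hle)
  rw [key hX hY, key hY hX, h2, mlieBracket_smul_right hf1.self_of_nhds (mdiff_of_contMDiffAt hZ),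
    hZp] at h1
  have h3 : (d% f p (mlieBracket I X Y p)
      - (d% (fun y ↦ d% f y (Y y)) p (X p) - d% (fun y ↦ d% f y (X y)) p (Y p))) • v = 0 := by
    linear_combination (norm := module) -h1
  exact sub_eq_zero.1 ((smul_eq_zero.1 h3).resolve_right hv)

/-! ### Symmetries of the curvature -/

lemma curvature_antisymm : curvature X Y Z p = -curvature Y X Z p := by
  simp only [curvature, nabla, mlieBracket_swap_apply (V := X) (W := Y), map_neg]
  abel

lemma curvature₄_antisymm_left : curvature₄ X Y Z W p = -curvature₄ Y X Z W p := by
  rw [curvature₄, curvature_antisymm, inner_neg_left, curvature₄]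

/-- The first Bianchi identity. -/
theorem curvature_bianchi (hX : CMDiffAt ∞ (T% X) p) (hY : CMDiffAt ∞ (T% Y) p)
    (hZ : CMDiffAt ∞ (T% Z) p) :
    curvature X Y Z p + curvature Y Z X p + curvature Z X Y p = 0 := by
  have hle : minSmoothness ℝ 2 ≤ (∞ : WithTop ℕ∞) := by
    rw [minSmoothness_of_isRCLikeNormedField]
    exact WithTop.coe_le_coe.2 le_top
  have : IsManifold I (minSmoothness ℝ 3) M := by
    rw [minSmoothness_of_isRCLikeNormedField]; infer_instance
  -- by vanishing of the torsion, `∇_A ∇_B C - ∇_A ∇_C B - ∇_[B, C] A = [A, [B, C]]`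
  have key : ∀ {A B C : Π x : M, TangentSpace I x}, CMDiffAt ∞ (T% A) p → CMDiffAt ∞ (T% B) p →
      CMDiffAt ∞ (T% C) p → nabla A (nabla B C) p - nabla A (nabla C B) p
        - nabla (mlieBracket I B C) A p = mlieBracket I A (mlieBracket I B C) p := by
    intro A B C hA hB hC
    have h1 := contMDiffAt_nabla hB hC
    have h2 := contMDiffAt_nabla hC hB
    have h3 := contMDiffAt_mlieBracket hB hC
    have h4 : nabla A (nabla B C) p = nabla A (nabla C B + mlieBracket I B C) p := by
      refine nabla_congr (mdiff_of_contMDiffAt h1)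
        (mdiff_of_contMDiffAt (h2.add_section h3)) ?_
      filter_upwards [eventually_mdifferentiableAt hB, eventually_mdifferentiableAt hC] with y h5 h6
      rw [Pi.add_apply, ← nabla_sub_nabla h5 h6]
      abel
    rw [h4, nabla_add_right (mdiff_of_contMDiffAt h2) (mdiff_of_contMDiffAt h3),
      ← nabla_sub_nabla (mdiff_of_contMDiffAt hA) (mdiff_of_contMDiffAt h3)]
    abel
  have h1 := key hX hY hZ
  have h2 := key hY hZ hX
  have h3 := key hZ hX hY
  have h4 := leibniz_identity_mlieBracket_apply (hX.of_le hle) (hY.of_le hle) (hZ.of_le hle)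
  have h5 : mlieBracket I Y (mlieBracket I Z X) p = -mlieBracket I Y (mlieBracket I X Z) p := by
    have h := mlieBracket_const_smul_right (V := Y) (c := (-1 : ℝ))
      (mdiff_of_contMDiffAt (contMDiffAt_mlieBracket hX hZ))
    rw [mlieBracket_swap (V := Z)]
    simpa using h
  have h6 := mlieBracket_swap_apply (I := I) (V := Z) (W := mlieBracket I X Y) (x := p)
  simp only [curvature]
  linear_combination (norm := module) h1 + h2 + h3 + h4 + h5 + h6

/-- The curvature operators are skew-adjoint, since the connection is metric. -/
theorem curvature₄_antisymm_right (hX : CMDiffAt ∞ (T% X) p) (hY : CMDiffAt ∞ (T% Y) p)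
    (hZ : CMDiffAt ∞ (T% Z) p) (hW : CMDiffAt ∞ (T% W) p) :
    curvature₄ X Y Z W p = -curvature₄ X Y W Z p := by
  have key : ∀ {A B : Π x : M, TangentSpace I x}, CMDiffAt ∞ (T% A) p → CMDiffAt ∞ (T% B) p →
      d% (fun y ↦ d% (metricFun Z W) y (B y)) p (A p)
        = inner ℝ (nabla A (nabla B Z) p) (W p) + inner ℝ (nabla B Z p) (nabla A W p)
          + (inner ℝ (nabla A Z p) (nabla B W p) + inner ℝ (Z p) (nabla A (nabla B W) p)) := by
    intro A B hA hB
    have hBZ := mdiff_of_contMDiffAt (contMDiffAt_nabla hB hZ)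
    have hBW := mdiff_of_contMDiffAt (contMDiffAt_nabla hB hW)
    have hA' := mdiff_of_contMDiffAt hA
    have hZ' := mdiff_of_contMDiffAt hZ
    have hW' := mdiff_of_contMDiffAt hW
    have h1 : (fun y ↦ d% (metricFun Z W) y (B y)) =ᶠ[𝓝 p]
        metricFun (nabla B Z) W + metricFun Z (nabla B W) := by
      filter_upwards [eventually_mdifferentiableAt hB, eventually_mdifferentiableAt hZ,
        eventually_mdifferentiableAt hW] with y h1 h2 h3
      exact mvfderiv_metricFun h1 h2 h3
    rw [mvfderiv_congr h1, mvfderiv_add (metricFun_mdiff hBZ hW') (metricFun_mdiff hZ' hBW),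
      add_apply, mvfderiv_metricFun hA' hBZ hW', mvfderiv_metricFun hA' hZ' hBW]
  have h1 := mvfderiv_mlieBracket (contMDiffAt_metricFun hZ hW) hX hY
  rw [key hX hY, key hY hX, mvfderiv_metricFun
    (mdiff_of_contMDiffAt (contMDiffAt_mlieBracket hX hY)) (mdiff_of_contMDiffAt hZ)
    (mdiff_of_contMDiffAt hW)] at h1
  simp only [curvature₄, curvature, inner_sub_left]
  simp only [real_inner_comm _ (Z p)] at h1 ⊢
  linarith

/-- The symmetry of the curvature in pairs, a formal consequence of the other symmetries. -/
theorem curvature₄_pair_symm (hX : CMDiffAt ∞ (T% X) p) (hY : CMDiffAt ∞ (T% Y) p)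
    (hZ : CMDiffAt ∞ (T% Z) p) (hW : CMDiffAt ∞ (T% W) p) :
    curvature₄ X Y Z W p = curvature₄ Z W X Y p := by
  have bianchi : ∀ {A B C : Π x : M, TangentSpace I x} (D : Π x : M, TangentSpace I x),
      CMDiffAt ∞ (T% A) p → CMDiffAt ∞ (T% B) p → CMDiffAt ∞ (T% C) p →
      curvature₄ A B C D p + curvature₄ B C A D p + curvature₄ C A B D p = 0 := by
    intro A B C D hA hB hC
    simp only [curvature₄, ← inner_add_left, curvature_bianchi hA hB hC, inner_zero_left]
  -- the claim is a signed sum of these four identities; the facts after them identify its terms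
  have b1 := bianchi W hX hY hZ
  have b2 := bianchi X hY hZ hW
  have b3 := bianchi Y hZ hW hX
  have b4 := bianchi Z hW hX hY
  have a1 := curvature₄_antisymm_right hX hY hZ hW
  have a2 := curvature₄_antisymm_right hY hZ hX hW
  have a3 := curvature₄_antisymm_right hZ hX hY hW
  have a4 := curvature₄_antisymm_right hZ hW hX hY
  have a5 := curvature₄_antisymm_right hW hX hY hZ
  have a6 := curvature₄_antisymm_right hY hW hX hZ
  have l1 := curvature₄_antisymm_left (X := W) (Y := Y) (Z := Z) (W := X) (p := p)
  have l5 := curvature₄_antisymm_left (X := Z) (Y := X) (Z := W) (W := Y) (p := p)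
  linarith

variable {φ : Π x : M, TangentSpace I x →L[ℝ] TangentSpace I x}
  {η : Π x : M, TangentSpace I x →L[ℝ] ℝ} {ξ : Π x : M, TangentSpace I x}

/-! ### Curvature of Kenmotsu manifolds -/

namespace IsAlmostContactMetric

lemma contMDiffAt_applyField (h : IsAlmostContactMetric φ η ξ) (hX : CMDiffAt ∞ (T% X) p) :
    CMDiffAt ∞ (T% (applyField φ X)) p :=
  ContMDiffAt.clm_bundle_apply (F₁ := E) (F₂ := E) (E₁ := fun x : M ↦ TangentSpace I x)
    (E₂ := fun x : M ↦ TangentSpace I x) (b := id) h.contMDiff_endo.contMDiffAt hX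

lemma inner_endo_left (h : IsAlmostContactMetric φ η ξ) (v w : TangentSpace I p) :
    inner ℝ (φ p v) w = -inner ℝ v (φ p w) := by
  have h1 := h.metric_endo p v (φ p w)
  have h2 := h.dual p (φ p v)
  rw [h.form_endo, real_inner_comm] at h2
  rw [h.form_endo, h.sq, inner_add_right, inner_smul_right, inner_neg_right, ← h2] at h1
  linarith

lemma inner_endo_self (h : IsAlmostContactMetric φ η ξ) (v : TangentSpace I p) :
    inner ℝ v (φ p v) = 0 := by
  have h1 := h.inner_endo_left v v
  rw [real_inner_comm] at h1
  linarith

end IsAlmostContactMetric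

namespace IsKenmotsu

/-- On a Kenmotsu manifold `∇_Y ξ = Y - η(Y) ξ`. -/
theorem nabla_reeb (h : IsKenmotsu φ η ξ) (hY : CMDiffAt ∞ (T% Y) p) :
    nabla Y ξ p = Y p - η p (Y p) • ξ p := by
  have hξ : CMDiffAt ∞ (T% ξ) p := h.contMDiff_reeb.contMDiffAt
  have hξ' := mdiff_of_contMDiffAt hξ
  have h1 := h.nabla_endo p Y ξ hY hξ
  have h0 : applyField φ ξ = 0 := by
    ext x
    exact h.endo_reeb x
  have h2 : φ p (nabla Y ξ p) = φ p (Y p) := by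
    have h3 : nabla Y (0 : Π x : M, TangentSpace I x) p = 0 := by
      simp [nabla]
    rw [nablaEndo, h0, h3, h.form_reeb, real_inner_comm, ← h.dual, h.form_endo] at h1
    simpa using h1
  -- `g(ξ, ξ)` is constant
  have h4 : η p (nabla Y ξ p) = 0 := by
    have h5 : metricFun ξ ξ = fun _ ↦ (1 : ℝ) := by
      ext x
      exact (h.dual x (ξ x)).symm.trans (h.form_reeb x)
    have h6 := mvfderiv_metricFun (mdiff_of_contMDiffAt hY) hξ' hξ'
    rw [h5, mvfderiv_const, real_inner_comm] at h6
    rw [h.dual]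
    simp at h6
    linarith
  have h7 := h.sq p (nabla Y ξ p)
  rw [h2, h4, h.sq] at h7
  linear_combination (norm := module) h7

/-- On a Kenmotsu manifold, the curvature operators on horizontal fields commute with `φ` up to the
terms that they have in constant curvature `-1`. The hypotheses are imposed near `p` because the
identity for `(∇_Y φ) Z` is differentiated, and being of class `C^∞` at `p` does not imply being of
class `C^∞` near `p`. -/
theorem curvature_applyField (h : IsKenmotsu φ η ξ) (hX : ∀ᶠ y in 𝓝 p, CMDiffAt ∞ (T% X) y)
    (hY : ∀ᶠ y in 𝓝 p, CMDiffAt ∞ (T% Y) y) (hZ : ∀ᶠ y in 𝓝 p, CMDiffAt ∞ (T% Z) y)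
    (hXη : ∀ᶠ y in 𝓝 p, η y (X y) = 0) (hYη : ∀ᶠ y in 𝓝 p, η y (Y y) = 0)
    (hZη : ∀ᶠ y in 𝓝 p, η y (Z y) = 0) :
    curvature X Y (applyField φ Z) p = φ p (curvature X Y Z p)
      + (inner ℝ (Y p) (Z p) : ℝ) • φ p (X p) - (inner ℝ (X p) (Z p) : ℝ) • φ p (Y p)
      + (inner ℝ (φ p (Y p)) (Z p) : ℝ) • X p - (inner ℝ (φ p (X p)) (Z p) : ℝ) • Y p := by
  have hφZ := hZ.mono fun _ h1 ↦ h.contMDiffAt_applyField h1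
  have nab : ∀ {y : M} {A B : Π x : M, TangentSpace I x}, CMDiffAt ∞ (T% A) y →
      CMDiffAt ∞ (T% B) y → nabla A (applyField φ B) y = φ y (nabla A B y)
        + ((inner ℝ (φ y (A y)) (B y) : ℝ) • ξ y - η y (B y) • φ y (A y)) := by
    intro y A B hA hB
    rw [← h.nabla_endo y A B hA hB, nablaEndo]
    abel
  -- the first two inner products in the coefficient of `ξ` are symmetric in `A` and `B`; the third
  -- one yields `g(φ [X, Y], Z)`, which cancels against the term from `∇_[X, Y] (φ Z)`
  have key : ∀ {A B : Π x : M, TangentSpace I x}, (∀ᶠ y in 𝓝 p, CMDiffAt ∞ (T% A) y) →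
      (∀ᶠ y in 𝓝 p, CMDiffAt ∞ (T% B) y) → (∀ᶠ y in 𝓝 p, η y (A y) = 0) →
      (∀ᶠ y in 𝓝 p, η y (B y) = 0) →
      nabla A (nabla B (applyField φ Z)) p = φ p (nabla A (nabla B Z) p)
        + (inner ℝ (φ p (A p)) (nabla B Z p) + inner ℝ (φ p (B p)) (nabla A Z p)
          + inner ℝ (φ p (nabla A B p)) (Z p) : ℝ) • ξ p
        + (inner ℝ (B p) (Z p) : ℝ) • φ p (A p) + (inner ℝ (φ p (B p)) (Z p) : ℝ) • A p := by
    intro A B hA hB hAη hBη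
    have hA0 := hA.self_of_nhds
    have hB0 := hB.self_of_nhds
    have hZ0 := hZ.self_of_nhds
    have hφB := h.contMDiffAt_applyField hB0
    have hξ : CMDiffAt ∞ (T% ξ) p := h.contMDiff_reeb.contMDiffAt
    have hBZ := contMDiffAt_nabla hB0 hZ0
    have hg := contMDiffAt_metricFun hφB hZ0
    have h1 : ∀ᶠ y in 𝓝 p, nabla B (applyField φ Z) y
        = (applyField φ (nabla B Z) + metricFun (applyField φ B) Z • ξ) y := by
      filter_upwards [hB, hZ, hZη] with y h1 h2 h3
      rw [nab h1 h2, h3, zero_smul, sub_zero]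
      rfl
    have h2 := h.contMDiffAt_applyField hBZ
    have h3 := hg.smul_section hξ
    -- differentiate `g(ξ, Z) = 0`
    have hη : η p (nabla B Z p) = -inner ℝ (B p) (Z p) := by
      have h4 : metricFun ξ Z =ᶠ[𝓝 p] fun _ ↦ (0 : ℝ) :=
        hZη.mono fun y hy ↦ (h.dual y _).symm.trans hy
      have h5 := mvfderiv_metricFun (mdiff_of_contMDiffAt hB0) (mdiff_of_contMDiffAt hξ)
        (mdiff_of_contMDiffAt hZ0)
      rw [mvfderiv_congr h4, mvfderiv_const, h.nabla_reeb hB0, hBη.self_of_nhds, ← h.dual] at h5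
      simp at h5
      linarith
    have hd : d% (metricFun (applyField φ B) Z) p (A p)
        = inner ℝ (φ p (nabla A B p)) (Z p) + inner ℝ (φ p (B p)) (nabla A Z p) := by
      rw [mvfderiv_metricFun (mdiff_of_contMDiffAt hA0) (mdiff_of_contMDiffAt hφB)
        (mdiff_of_contMDiffAt hZ0), nab hA0 hB0, hBη.self_of_nhds, inner_add_left, inner_sub_left,
        inner_smul_left, inner_smul_left, ← h.dual, hZη.self_of_nhds]
      simp [applyField]
    rw [nabla_congr (mdiff_of_contMDiffAt (contMDiffAt_nabla hB0 hφZ.self_of_nhds))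
      (mdiff_of_contMDiffAt (h2.add_section h3)) h1,
      nabla_add_right (mdiff_of_contMDiffAt h2) (mdiff_of_contMDiffAt h3),
      nabla_smul_right (hg.mdifferentiableAt (by simp)) (mdiff_of_contMDiffAt hξ), nab hA0 hBZ,
      hd, hη, h.nabla_reeb hA0, hAη.self_of_nhds]
    simp only [metricFun, applyField]
    module
  have hX0 := hX.self_of_nhds
  have hY0 := hY.self_of_nhds
  have hlie := nabla_sub_nabla (mdiff_of_contMDiffAt hX0) (mdiff_of_contMDiffAt hY0)
  simp only [curvature]
  rw [key hX hY hXη hYη, key hY hX hYη hXη,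
    nab (contMDiffAt_mlieBracket hX0 hY0) hZ.self_of_nhds, hZη.self_of_nhds, ← hlie]
  simp only [map_sub, inner_sub_left]
  module

/-- The effect of `φ` on the last two arguments of the curvature tensor of a Kenmotsu manifold. -/
theorem curvature₄_applyField (h : IsKenmotsu φ η ξ) (hX : ∀ᶠ y in 𝓝 p, CMDiffAt ∞ (T% X) y)
    (hY : ∀ᶠ y in 𝓝 p, CMDiffAt ∞ (T% Y) y) (hZ : ∀ᶠ y in 𝓝 p, CMDiffAt ∞ (T% Z) y)
    (hXη : ∀ᶠ y in 𝓝 p, η y (X y) = 0) (hYη : ∀ᶠ y in 𝓝 p, η y (Y y) = 0)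
    (hZη : ∀ᶠ y in 𝓝 p, η y (Z y) = 0) (hWη : η p (W p) = 0) :
    curvature₄ X Y (applyField φ Z) (applyField φ W) p = curvature₄ X Y Z W p
      + inner ℝ (Y p) (Z p) * inner ℝ (X p) (W p) - inner ℝ (X p) (Z p) * inner ℝ (Y p) (W p)
      + inner ℝ (φ p (Y p)) (Z p) * inner ℝ (X p) (φ p (W p))
      - inner ℝ (φ p (X p)) (Z p) * inner ℝ (Y p) (φ p (W p)) := by
  simp only [curvature₄]
  rw [h.curvature_applyField hX hY hZ hXη hYη hZη]
  simp only [applyField, inner_add_left, inner_sub_left, real_inner_smul_left, h.metric_endo, hWη,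
    mul_zero, sub_zero]

end IsKenmotsu

/-! ### The sum of the three holomorphic sectional curvatures -/

/-- On a 3-Kenmotsu manifold, for a horizontal field `X`, the sum of `R(X, φ_α X, X, φ_α X)` over
`α` is `3 g(X, X) ^ 2`. Moving `φ`'s between the last two arguments turns the three summands of the
first Bianchi identity for `X`, `φ₁ X`, `φ₂ X`, paired with `φ₃ X`, into
`g(X, X) ^ 2 - R(X, φ_α X, X, φ_α X)`. -/
theorem IsThreeKenmotsu.sum_curvature₄
    {φ : Fin 3 → Π x : M, TangentSpace I x →L[ℝ] TangentSpace I x}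
    (h : IsThreeKenmotsu φ η ξ) (hX : ∀ᶠ y in 𝓝 p, CMDiffAt ∞ (T% X) y)
    (hXη : ∀ᶠ y in 𝓝 p, η y (X y) = 0) :
    curvature₄ X (applyField (φ 0) X) X (applyField (φ 0) X) p
      + curvature₄ X (applyField (φ 1) X) X (applyField (φ 1) X) p
      + curvature₄ X (applyField (φ 2) X) X (applyField (φ 2) X) p
      = 3 * (inner ℝ (X p) (X p)) ^ 2 := by
  have K := h.isKenmotsu
  have hφ : ∀ α, ∀ᶠ y in 𝓝 p, CMDiffAt ∞ (T% (applyField (φ α) X)) y := fun α ↦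
    hX.mono fun _ h1 ↦ (K α).contMDiffAt_applyField h1
  have hφη : ∀ α, ∀ᶠ y in 𝓝 p, η y (applyField (φ α) X y) = 0 := fun α ↦
    .of_forall fun y ↦ (K α).form_endo y _
  have hX0 := hX.self_of_nhds
  have hη0 := hXη.self_of_nhds
  have hφ0 := fun α ↦ (hφ α).self_of_nhds
  -- the products `φ₂ φ₁ = -φ₃` and `φ₁ φ₃ = -φ₂`, from the cyclic relations and `φ_α ^ 2 = -1` on `H`
  have h10 : φ 1 p (φ 0 p (X p)) = -φ 2 p (X p) := by
    rw [h.comp₂₃, (K 1).sq, (K 2).form_endo]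
    simp
  have h02 : φ 0 p (φ 2 p (X p)) = -φ 1 p (X p) := by
    rw [h.comp₁₂, (K 0).sq, (K 1).form_endo]
    simp
  have z : ∀ α, inner ℝ (X p) (φ α p (X p)) = 0 := fun α ↦ (K α).inner_endo_self _
  have z' : ∀ α, inner ℝ (φ α p (X p)) (X p) = 0 := fun α ↦ by rw [real_inner_comm, z]
  have nrm : ∀ α, inner ℝ (φ α p (X p)) (φ α p (X p)) = inner ℝ (X p) (X p) := fun α ↦ by
    rw [(K α).metric_endo, hη0]
    simp
  have neg : ∀ {A B C D D' : Π x : M, TangentSpace I x}, D p = -D' p →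
      curvature₄ A B C D p = -curvature₄ A B C D' p := by
    intro A B C D D' hD
    rw [curvature₄, hD, inner_neg_right, curvature₄]
  -- the three summands of the Bianchi identity `b`
  have e0 := (K 1).curvature₄_applyField (W := applyField (φ 0) X) hX (hφ 0) hX hXη (hφη 0) hXη
    (hφη 0).self_of_nhds
  have e1 := (K 0).curvature₄_applyField (W := applyField (φ 1) X) (hφ 1) hX hX (hφη 1) hXη hXη
    (hφη 1).self_of_nhds
  have e2 := (K 0).curvature₄_applyField (W := applyField (φ 2) X) hX (hφ 2) hX hXη (hφη 2) hXη
    (hφη 2).self_of_nhds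
  rw [neg (D' := applyField (φ 2) X) h10] at e0
  rw [neg (D' := applyField (φ 1) X) h02,
    curvature₄_pair_symm hX0 (hφ0 2) (hφ0 0) (hφ0 1)] at e2
  have h12 : applyField (φ 0) (applyField (φ 1) X) = applyField (φ 2) X := by
    ext x
    exact (h.comp₁₂ x _).symm
  rw [h12, curvature₄_antisymm_left (X := applyField (φ 1) X) (Y := X) (Z := X)] at e1
  have b : curvature₄ X (applyField (φ 0) X) (applyField (φ 1) X) (applyField (φ 2) X) p
      + curvature₄ (applyField (φ 0) X) (applyField (φ 1) X) X (applyField (φ 2) X) p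
      + curvature₄ (applyField (φ 1) X) X (applyField (φ 0) X) (applyField (φ 2) X) p = 0 := by
    simp only [curvature₄, ← inner_add_left, curvature_bianchi hX0 (hφ0 0) (hφ0 1), inner_zero_left]
  simp only [applyField, h10, h02, ← h.comp₁₂, z, z', nrm, inner_neg_left] at e0 e1 e2
  linarith

theorem IsThreeKenmotsu.sum_holomorphicSectionalCurvature
    {φ : Fin 3 → Π x : M, TangentSpace I x →L[ℝ] TangentSpace I x}
    (h : IsThreeKenmotsu φ η ξ) (hX : ∀ᶠ y in 𝓝 p, CMDiffAt ∞ (T% X) y)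
    (hXη : ∀ᶠ y in 𝓝 p, η y (X y) = 0) (hXp : X p ≠ 0) :
    holomorphicSectionalCurvature (φ 0) X p + holomorphicSectionalCurvature (φ 1) X p
      + holomorphicSectionalCurvature (φ 2) X p = -3 := by
  have hn : (inner ℝ (X p) (X p) : ℝ) ≠ 0 := inner_self_ne_zero.2 hXp
  -- `X` and `φ_α X` are orthogonal and of the same length
  have key : ∀ α, holomorphicSectionalCurvature (φ α) X p
      = -curvature₄ X (applyField (φ α) X) X (applyField (φ α) X) p
        / (inner ℝ (X p) (X p)) ^ 2 := by
    intro α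
    have K := h.isKenmotsu α
    rw [holomorphicSectionalCurvature, sectionalCurvature]
    congr 1
    simp only [metricFun, applyField, K.metric_endo, K.inner_endo_self, hXη.self_of_nhds]
    ring
  rw [key, key, key, ← add_div, ← add_div, div_eq_iff (pow_ne_zero 2 hn)]
  linear_combination -h.sum_curvature₄ hX hXη

end Riem

end

theorem mainTheorem2 (m : ℕ) (M : Type*) [TopologicalSpace M]
    [ChartedSpace (EuclideanSpace ℝ (Fin m)) M] [IsManifold (𝓡 m) ∞ M]
    [RiemannianBundle (fun x : M ↦ TangentSpace (𝓡 m) x)]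
    [IsContMDiffRiemannianBundle (𝓡 m) ∞ (EuclideanSpace ℝ (Fin m))
      (fun x : M ↦ TangentSpace (𝓡 m) x)]
    (φ : Fin 3 → Π x : M, TangentSpace (𝓡 m) x →L[ℝ] TangentSpace (𝓡 m) x)
    (η : Π x : M, TangentSpace (𝓡 m) x →L[ℝ] ℝ)
    (ξ : Π x : M, TangentSpace (𝓡 m) x)
    (h : Riem.IsThreeKenmotsu φ η ξ)
    (U : Set M) (hU : IsOpen U)
    (X : Π x : M, TangentSpace (𝓡 m) x)
    (hX : ContMDiffOn (𝓡 m) (𝓡 m).tangent ∞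
      (fun x ↦ (⟨x, X x⟩ : TangentBundle (𝓡 m) M)) U)
    (hXH : ∀ x ∈ U, X x ∈ Riem.horizontal η x)
    (p : M) (hp : p ∈ U) (hXp : X p ≠ 0) :
    Riem.holomorphicSectionalCurvature (φ 0) X p
      + Riem.holomorphicSectionalCurvature (φ 1) X p
      + Riem.holomorphicSectionalCurvature (φ 2) X p = -3 := by
  refine h.sum_holomorphicSectionalCurvature ?_ ?_ hXp
  · filter_upwards [hU.mem_nhds hp] with y hy using hX.contMDiffAt (hU.mem_nhds hy)
  · filter_upwards [hU.mem_nhds hp] with y hy using hXH y hy
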